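/- Let $p$ be a prime, let $\nu\ge 1$ be an integer, and let $G$ be a free abelian group of arbitrary rank. Write $\bar x$ for the image of $x\in G$ in $G/p^\nu G$. (1) For every basis $\{b_\alpha\}_{\alpha\in I}$ of $G/p^\nu G$ as a $\mathbb Z/p^\nu\mathbb Z$-module, there are integers $u_\alpha$ ($\alpha\in I$), each relatively prime to $p$, and a $\mathbb Z$-basis $\{y_\alpha\}_{\alpha\in I}$ of $G$, indexed by the same set $I$, such that $\bar y_\alpha=u_\alpha b_\alpha$ in $G/p^\nu G$ for all $\alpha\in I$. (2) Every direct sum decomposition of $G/p^\nu G$ lifts to one of $G$: whenever $G/p^\nu G=\bigoplus_{j\in J}M_j$ is an internal direct sum of subgroups $M_j$, there are subgroups $N_j$ of $G$ such that $G=\bigoplus_{j\in J}N_j$ is an internal direct sum and the image of $N_j$ in $G/p^\nu G$ equals $M_j$ for every $j\in J$. -/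

import Mathlib

/-!
Write `R = ℤ/p^ν`. After choosing a basis of `G` indexed by `I` (the rank of a free module is
determined by its reduction), the first claim says that every automorphism `φ` of `R^(I)` is, up to
rescaling the basis vectors by units, the reduction of an automorphism of `ℤ^(I)`. Such
automorphisms are called liftable. Elementary automorphisms `(x, y) ↦ (x + f y, y)` are liftable,
because maps out of free modules lift, and so are permutations of the basis. Hence, if some vectors
`x_k` and their images `φ x_k` both have the identity as coordinate matrix on suitable sets of
coordinates with equipotent complements, then `φ` differs by liftable automorphisms from a
block-diagonal `1 ⊕ θ`, where `1` acts on the span of the `x_k`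
(`Liftable.of_map_graph_eq_graph`, `exists_liftable_of_map_eq_graph`).

In finite rank one vector is split off at a time. The image of a basis vector is unimodular, so it
has a unit coordinate as `R` is local; rescaling turns this coordinate into `1`. This is where the
units `u_α` are needed (`exists_scaling_liftable`).

In infinite rank no rescaling is needed. A counting argument based on the finiteness of `R` and
Zorn's lemma yields as many vectors `x_k` as the rank (`exists_dual_family`), so that `φ` may be
replaced by `1 ⊕ θ` where `1` acts on a summand of full rank. This is liftable by an Eilenberg
swindle (`Liftable.prodCongr_refl_refl`) combined with Whitehead's lemma that `θ ⊕ θ⁻¹` is a product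
of elementary automorphisms (`Liftable.prodCongr_symm`).

For the second claim, the summands `M_j` are projective over the local Artinian ring `R`, hence free
(`Module.Free.of_flat_of_isArtinianRing`). The union of bases of the `M_j` is a basis of `G/p^ν G`.
The first claim lifts it to a basis of `G`, and `N_j` is spanned by the part of it that belongs
to `j`.
-/

/-! ### Liftable isomorphisms -/

/-- `Liftable q q' φ`: the isomorphism `φ : M ≃+ M'` lifts along `q : G →+ M` and
`q' : G' →+ M'` to an isomorphism `G ≃+ G'`. -/
def Liftable {G G' M M' : Type*} [AddCommGroup G] [AddCommGroup G'] [AddCommGroup M]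
    [AddCommGroup M'] (q : G →+ M) (q' : G' →+ M') (φ : M ≃+ M') : Prop :=
  ∃ ψ : G ≃+ G', ∀ x, q' (ψ x) = φ (q x)

/-- The elementary automorphism `(x, y) ↦ (x + f y, y)`. -/
def shearFst {A B : Type*} [AddCommGroup A] [AddCommGroup B] (f : B →+ A) : A × B ≃+ A × B where
  toFun z := (z.1 + f z.2, z.2)
  invFun z := (z.1 - f z.2, z.2)
  left_inv z := by simp
  right_inv z := by simp
  map_add' z w := by ext <;> simp [add_add_add_comm]

/-- The elementary automorphism `(x, y) ↦ (x, y + f x)`. -/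
def shearSnd {A B : Type*} [AddCommGroup A] [AddCommGroup B] (f : A →+ B) : A × B ≃+ A × B where
  toFun z := (z.1, z.2 + f z.1)
  invFun z := (z.1, z.2 - f z.1)
  left_inv z := by simp
  right_inv z := by simp
  map_add' z w := by ext <;> simp [add_add_add_comm]

/-- The quarter turn `(x, y) ↦ (-y, x)`. -/
def quarterTurn (A : Type*) [AddCommGroup A] : A × A ≃+ A × A where
  toFun z := (-z.2, z.1)
  invFun z := (z.2, -z.1)
  left_inv z := by simp
  right_inv z := by simp
  map_add' z w := by ext <;> simp [add_comm]

section

variable {A B : Type*} [AddCommGroup A] [AddCommGroup B]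

@[simp] lemma shearFst_apply (f : B →+ A) (z : A × B) : shearFst f z = (z.1 + f z.2, z.2) := rfl

@[simp] lemma shearSnd_apply (f : A →+ B) (z : A × B) : shearSnd f z = (z.1, z.2 + f z.1) := rfl

@[simp] lemma quarterTurn_apply (z : A × A) : quarterTurn A z = (-z.2, z.1) := rfl

lemma AddEquiv.prodCongr_apply {A' B' : Type*} [AddCommGroup A'] [AddCommGroup B']
    (e : A ≃+ A') (e' : B ≃+ B') (z : A × B) : e.prodCongr e' z = (e z.1, e' z.2) := rfl

end

namespace Liftable

variable {G G' G'' M M' M'' : Type*} [AddCommGroup G] [AddCommGroup G'] [AddCommGroup G'']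
  [AddCommGroup M] [AddCommGroup M'] [AddCommGroup M''] {q : G →+ M} {q' : G' →+ M'}
  {q'' : G'' →+ M''}

lemma refl (q : G →+ M) : Liftable q q (AddEquiv.refl M) := ⟨AddEquiv.refl G, fun _ ↦ rfl⟩

lemma symm {φ : M ≃+ M'} (h : Liftable q q' φ) : Liftable q' q φ.symm := by
  obtain ⟨ψ, hψ⟩ := h
  refine ⟨ψ.symm, fun x ↦ ?_⟩
  rw [AddEquiv.eq_symm_apply, ← hψ, AddEquiv.apply_symm_apply]

lemma trans {φ : M ≃+ M'} {φ' : M' ≃+ M''} (h : Liftable q q' φ) (h' : Liftable q' q'' φ') :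
    Liftable q q'' (φ.trans φ') := by
  obtain ⟨ψ, hψ⟩ := h
  obtain ⟨ψ', hψ'⟩ := h'
  exact ⟨ψ.trans ψ', fun x ↦ by simp [hψ, hψ']⟩

lemma congr {φ φ' : M ≃+ M'} (h : Liftable q q' φ) (hφ : ∀ x, φ x = φ' x) :
    Liftable q q' φ' := by
  rwa [← AddEquiv.ext hφ]

lemma prodCongr {H H' N N' : Type*} [AddCommGroup H] [AddCommGroup H'] [AddCommGroup N]
    [AddCommGroup N'] {r : H →+ N} {r' : H' →+ N'} {φ : M ≃+ M'} {θ : N ≃+ N'}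
    (h : Liftable q q' φ) (h' : Liftable r r' θ) :
    Liftable (q.prodMap r) (q'.prodMap r') (φ.prodCongr θ) := by
  obtain ⟨ψ, hψ⟩ := h
  obtain ⟨ψ', hψ'⟩ := h'
  exact ⟨ψ.prodCongr ψ', fun x ↦ by ext <;> simp [AddEquiv.prodCongr_apply, hψ, hψ']⟩

lemma prodAssoc (q : G →+ M) (q' : G' →+ M') (q'' : G'' →+ M'') :
    Liftable ((q.prodMap q').prodMap q'') (q.prodMap (q'.prodMap q''))
      (AddEquiv.prodAssoc (M := M) (N := M') (P := M'')) :=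
  ⟨AddEquiv.prodAssoc, fun _ ↦ rfl⟩

lemma prodComm (q : G →+ M) (q' : G' →+ M') :
    Liftable (q.prodMap q') (q'.prodMap q) (AddEquiv.prodComm (M := M) (N := M')) :=
  ⟨AddEquiv.prodComm, fun _ ↦ rfl⟩

lemma domCongr (q : G →+ M) {ι κ : Type*} (e : ι ≃ κ) :
    Liftable (Finsupp.mapRange.addMonoidHom q) (Finsupp.mapRange.addMonoidHom q)
      (Finsupp.domCongr e : (ι →₀ M) ≃+ (κ →₀ M)) :=
  ⟨Finsupp.domCongr e, fun x ↦ by ext; simp⟩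

lemma sumFinsupp (q : G →+ M) (ι κ : Type*) :
    Liftable (Finsupp.mapRange.addMonoidHom q)
      ((Finsupp.mapRange.addMonoidHom q).prodMap (Finsupp.mapRange.addMonoidHom q))
      (Finsupp.sumFinsuppAddEquivProdFinsupp : (ι ⊕ κ →₀ M) ≃+ _) :=
  ⟨Finsupp.sumFinsuppAddEquivProdFinsupp, fun x ↦ by ext <;> simp⟩

lemma curry (q : G →+ M) (ι κ : Type*) :
    Liftable (Finsupp.mapRange.addMonoidHom q)
      (Finsupp.mapRange.addMonoidHom (Finsupp.mapRange.addMonoidHom q))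
      (Finsupp.curryAddEquiv : (ι × κ →₀ M) ≃+ (ι →₀ κ →₀ M)) :=
  ⟨Finsupp.curryAddEquiv, fun x ↦ by ext; simp⟩

/-- Homomorphisms lift along a surjection, irrespective of `q`, because `G` is projective. -/
lemma exists_lift_hom [Module.Free ℤ G] (q : G →+ M) (hq' : Function.Surjective q')
    (f : M →+ M') : ∃ g : G →+ G', ∀ x, q' (g x) = f (q x) := by
  obtain ⟨g, hg⟩ := Module.projective_lifting_property q'.toIntLinearMap
    (f.comp q).toIntLinearMap hq'
  exact ⟨g.toAddMonoidHom, fun x ↦ DFunLike.congr_fun hg x⟩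

lemma shearFst [Module.Free ℤ G'] (hq : Function.Surjective q) (f : M' →+ M) :
    Liftable (q.prodMap q') (q.prodMap q') (shearFst f) := by
  obtain ⟨g, hg⟩ := exists_lift_hom q' hq f
  exact ⟨_root_.shearFst g, fun x ↦ by ext <;> simp [hg]⟩

lemma shearSnd [Module.Free ℤ G] (hq' : Function.Surjective q') (f : M →+ M') :
    Liftable (q.prodMap q') (q.prodMap q') (shearSnd f) := by
  obtain ⟨g, hg⟩ := exists_lift_hom q hq' f
  exact ⟨_root_.shearSnd g, fun x ↦ by ext <;> simp [hg]⟩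

lemma quarterTurn (q : G →+ M) :
    Liftable (q.prodMap q) (q.prodMap q) (quarterTurn M) :=
  ⟨_root_.quarterTurn G, fun x ↦ by ext <;> simp⟩

/-- Whitehead's lemma: `φ ⊕ φ⁻¹` is a product of elementary automorphisms and a quarter turn. -/
lemma prodCongr_symm [Module.Free ℤ G] (hq : Function.Surjective q) (φ : M ≃+ M) :
    Liftable (q.prodMap q) (q.prodMap q) (φ.prodCongr φ.symm) := by
  refine ((quarterTurn q).trans <| (shearFst hq φ.toAddMonoidHom).trans <|
    (shearSnd hq (-φ.symm.toAddMonoidHom)).trans (shearFst hq φ.toAddMonoidHom)).congr fun x ↦ ?_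
  ext <;> simp [AddEquiv.prodCongr_apply]

/-- `M ⊕ M^(ℕ) ≃ M^(ℕ)`, prepending an entry to a sequence. -/
noncomputable def consEquiv (M : Type*) [AddCommGroup M] : M × (ℕ →₀ M) ≃+ (ℕ →₀ M) :=
  ((Finsupp.uniqueLinearEquiv ℤ M ()).symm.toAddEquiv.prodCongr (AddEquiv.refl _)).trans <|
    Finsupp.sumFinsuppAddEquivProdFinsupp.symm.trans <|
      Finsupp.domCongr ((Equiv.sumComm _ _).trans Equiv.natSumPUnitEquivNat)

lemma consEquiv_zero (z : M × (ℕ →₀ M)) : consEquiv M z 0 = z.1 := by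
  have h : Equiv.natSumPUnitEquivNat.symm 0 = Sum.inr () := rfl
  simp [h, consEquiv, AddEquiv.prodCongr_apply]

lemma consEquiv_succ (z : M × (ℕ →₀ M)) (n : ℕ) : consEquiv M z (n + 1) = z.2 n := by
  have h : Equiv.natSumPUnitEquivNat.symm (n + 1) = (Sum.inl n : ℕ ⊕ Unit) := rfl
  simp [h, consEquiv, AddEquiv.prodCongr_apply]

lemma cons (q : G →+ M) :
    Liftable (q.prodMap (Finsupp.mapRange.addMonoidHom q)) (Finsupp.mapRange.addMonoidHom q)
      (consEquiv M) :=
  ⟨consEquiv G, fun x ↦ by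
    ext n
    cases n <;> simp [consEquiv_zero, consEquiv_succ]⟩

/-- Eilenberg swindle: with `Φ = φ ⊕ φ ⊕ ⋯` on `A = M^(ℕ)`, the automorphism `φ ⊕ 1 ⊕ 1` of
`M ⊕ A ⊕ A` is the composite of `1 ⊕ Φ⁻¹ ⊕ Φ` and `φ ⊕ Φ ⊕ Φ⁻¹`. The latter becomes `Φ ⊕ Φ⁻¹`
after identifying `M ⊕ A` with `A`, so that Whitehead's lemma applies to both factors. -/
lemma prodCongr_refl_refl [Module.Free ℤ G] (hq : Function.Surjective q) (φ : M ≃+ M) :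
    Liftable
      (q.prodMap ((Finsupp.mapRange.addMonoidHom (ι := ℕ) q).prodMap
        (Finsupp.mapRange.addMonoidHom (ι := ℕ) q)))
      (q.prodMap ((Finsupp.mapRange.addMonoidHom (ι := ℕ) q).prodMap
        (Finsupp.mapRange.addMonoidHom (ι := ℕ) q)))
      (φ.prodCongr (AddEquiv.refl _)) := by
  have hqA : Function.Surjective (Finsupp.mapRange.addMonoidHom (ι := ℕ) q) :=
    Finsupp.mapRange_surjective q (map_zero q) hq
  let Φ : (ℕ →₀ M) ≃+ (ℕ →₀ M) := Finsupp.mapRange.addEquiv φ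
  have hs : ∀ x y, Φ (consEquiv M (x, Φ.symm y)) = consEquiv M (φ x, y) := by
    intro x y
    ext n
    cases n <;> simp [Φ, consEquiv_zero, consEquiv_succ]
  have h₁ := (refl q).prodCongr (prodCongr_symm hqA Φ.symm)
  have hc := (prodAssoc q (Finsupp.mapRange.addMonoidHom (ι := ℕ) q)
    (Finsupp.mapRange.addMonoidHom (ι := ℕ) q)).symm.trans
      ((cons q).prodCongr (refl (Finsupp.mapRange.addMonoidHom (ι := ℕ) q)))
  have h₂ := hc.trans ((prodCongr_symm hqA Φ).trans hc.symm)
  refine (h₁.trans h₂).congr fun z ↦ ?_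
  obtain ⟨x, y, w⟩ := z
  simp only [AddEquiv.trans_apply]
  rw [AddEquiv.symm_apply_eq]
  change (Φ (consEquiv M (x, Φ.symm y)), Φ.symm (Φ w)) = (consEquiv M (φ x, y), w)
  rw [hs, AddEquiv.symm_apply_apply]

end Liftable

/-! ### Block-triangular automorphisms -/

section Triangular

variable {P Q GP GQ : Type*} [AddCommGroup P] [AddCommGroup Q] [AddCommGroup GP]
  [AddCommGroup GQ] [Module.Free ℤ GQ] {q : GP →+ P} {r : GQ →+ Q}

/-- An automorphism of `P ⊕ Q` that fixes `P` pointwise induces an automorphism of the quotient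
`Q`. -/
lemma exists_addEquiv_snd_of_fix {φ : P × Q ≃+ P × Q} (hφ : ∀ x, φ (x, 0) = (x, 0)) :
    ∃ θ : Q ≃+ Q, ∀ x y, (φ (x, y)).2 = θ y := by
  have hφ' : ∀ x, φ.symm (x, 0) = (x, 0) := fun x ↦ by rw [AddEquiv.symm_apply_eq, hφ]
  have split : ∀ z : P × Q, z = (z.1, 0) + (0, z.2) := fun z ↦ by simp
  have key : ∀ (χ : P × Q ≃+ P × Q), (∀ x, χ (x, 0) = (x, 0)) → ∀ z, (χ z).2 = (χ (0, z.2)).2 :=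
    fun χ h z ↦ by
      conv_lhs => rw [split z, map_add, h]
      simp
  refine ⟨{ toFun := fun y ↦ (φ (0, y)).2
            invFun := fun y ↦ (φ.symm (0, y)).2
            left_inv := fun y ↦ ?_
            right_inv := fun y ↦ ?_
            map_add' := fun y z ↦ ?_ }, fun x y ↦ key φ hφ (x, y)⟩
  · exact (key φ.symm hφ' (φ (0, y))).symm.trans (by simp)
  · exact (key φ hφ (φ.symm (0, y))).symm.trans (by simp)
  · rw [← Prod.snd_add, ← map_add]; simp

/-- An automorphism of `P ⊕ Q` that is block upper triangular with identity first diagonal block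
is liftable as soon as its block-diagonal part is. -/
lemma Liftable.of_fix (hq : Function.Surjective q)
    {φ : P × Q ≃+ P × Q} (hφ : ∀ x, φ (x, 0) = (x, 0)) {θ : Q ≃+ Q}
    (hθ : ∀ x y, (φ (x, y)).2 = θ y)
    (h : Liftable (q.prodMap r) (q.prodMap r) ((AddEquiv.refl P).prodCongr θ)) :
    Liftable (q.prodMap r) (q.prodMap r) φ := by
  let f : Q →+ P := (AddMonoidHom.fst P Q).comp (φ.toAddMonoidHom.comp (AddMonoidHom.inr P Q))
  refine ((Liftable.shearFst hq f).trans h).congr fun z ↦ ?_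
  obtain ⟨x, y⟩ := z
  have : φ (x, y) = φ (x, 0) + φ (0, y) := by rw [← map_add]; simp
  ext
  · rw [this, hφ]; simp [AddEquiv.prodCongr_apply, f]
  · simp [AddEquiv.prodCongr_apply, hθ]

/-- If `φ` maps `P` onto the graph of a homomorphism `P → Q`, then, up to liftable automorphisms,
it is `1 ⊕ θ` for an automorphism `θ` of `Q`. The automorphism `δ` allows for rescaling. -/
lemma exists_liftable_of_map_eq_graph [Module.Free ℤ GP] (hq : Function.Surjective q)
    (hr : Function.Surjective r)
    {φ : P × Q ≃+ P × Q} (g : P →+ Q) (hφ : ∀ x, φ (x, 0) = (x, g x)) :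
    ∃ θ : Q ≃+ Q, ∀ δ : Q ≃+ Q,
      Liftable (q.prodMap r) (q.prodMap r) ((AddEquiv.refl P).prodCongr (δ.trans θ)) →
      Liftable (q.prodMap r) (q.prodMap r) (((AddEquiv.refl P).prodCongr δ).trans φ) := by
  have hfix : ∀ x, (φ.trans (shearSnd (-g))) (x, 0) = (x, 0) := fun x ↦ by simp [hφ]
  obtain ⟨θ, hθ⟩ := exists_addEquiv_snd_of_fix hfix
  refine ⟨θ, fun δ hδ ↦ ?_⟩
  have h := Liftable.of_fix (φ := ((AddEquiv.refl P).prodCongr δ).trans (φ.trans (shearSnd (-g))))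
    hq (fun x ↦ by simpa [AddEquiv.prodCongr_apply] using hfix x) (θ := δ.trans θ)
    (fun x y ↦ hθ x (δ y)) hδ
  refine (h.trans (Liftable.shearSnd hr g)).congr fun z ↦ ?_
  ext <;> simp

/-- If `φ` maps the graph of a homomorphism `P → Q` onto another such graph, compatibly with the
projections to `P`, and all automorphisms `1 ⊕ θ` are liftable, then so is `φ`. -/
lemma Liftable.of_map_graph_eq_graph [Module.Free ℤ GP] (hq : Function.Surjective q)
    (hr : Function.Surjective r)
    {φ : P × Q ≃+ P × Q} (f g : P →+ Q) (hφ : ∀ x, φ (x, f x) = (x, g x))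
    (h : ∀ θ : Q ≃+ Q, Liftable (q.prodMap r) (q.prodMap r) ((AddEquiv.refl P).prodCongr θ)) :
    Liftable (q.prodMap r) (q.prodMap r) φ := by
  obtain ⟨θ, hθ⟩ := exists_liftable_of_map_eq_graph (φ := (_root_.shearSnd f).trans φ) hq hr g
    (fun x ↦ by simpa using hφ x)
  refine ((Liftable.shearSnd hr (-f)).trans (hθ (AddEquiv.refl Q) (h _))).congr fun z ↦ ?_
  simp [AddEquiv.prodCongr_apply]

end Triangular

/-! ### Coordinates modulo `n` -/

section Coordinates

variable {n : ℕ}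

/-- Reduction modulo `n` of integral vectors with finite support. -/
noncomputable def reduce (n : ℕ) (E : Type*) : (E →₀ ℤ) →+ (E →₀ ZMod n) :=
  Finsupp.mapRange.addMonoidHom (Int.castAddHom (ZMod n))

lemma reduce_surjective (n : ℕ) (E : Type*) : Function.Surjective (reduce n E) :=
  Finsupp.mapRange_surjective _ (map_zero _) ZMod.intCast_surjective

/-- A nonzero element of `ℤ/p^ν` that annihilates all nonunits, namely `p^(ν-1)`. -/
lemma exists_ne_zero_mul_nonunit_eq_zero {p ν : ℕ} (hp : p.Prime) (hν : 1 ≤ ν) :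
    ∃ s : ZMod (p ^ ν), s ≠ 0 ∧ ∀ r, ¬IsUnit r → s * r = 0 := by
  have : NeZero (p ^ ν) := ⟨pow_ne_zero _ hp.ne_zero⟩
  refine ⟨(p ^ (ν - 1) : ℕ), fun h ↦ ?_, fun r hr ↦ ?_⟩
  · rw [ZMod.natCast_eq_zero_iff, Nat.pow_dvd_pow_iff_le_right hp.one_lt] at h
    omega
  · obtain ⟨m, rfl⟩ : ∃ m : ℕ, (m : ZMod (p ^ ν)) = r := ⟨r.val, ZMod.natCast_zmod_val r⟩
    rw [ZMod.isUnit_iff_coprime, Nat.coprime_pow_right_iff hν, Nat.coprime_comm,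
      hp.coprime_iff_not_dvd, not_not] at hr
    rw [← Nat.cast_mul, ZMod.natCast_eq_zero_iff]
    calc p ^ ν = p ^ (ν - 1) * p := by rw [← pow_succ, Nat.sub_add_cancel hν]
      _ ∣ _ := mul_dvd_mul_left _ hr

/-- Isomorphisms preserve unimodularity: a vector with all coordinates nonunits is killed by a
nonzero scalar, one with a unit coordinate is not. -/
lemma exists_isUnit_apply (hn : ∃ s : ZMod n, s ≠ 0 ∧ ∀ r, ¬IsUnit r → s * r = 0)
    {E F : Type*} (φ : (E →₀ ZMod n) ≃+ (F →₀ ZMod n)) {x : E →₀ ZMod n} {a : E}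
    (hx : IsUnit (x a)) : ∃ c, IsUnit (φ x c) := by
  obtain ⟨s, hs, hs'⟩ := hn
  by_contra! h
  have h₁ : φ (s • x) = 0 := by
    rw [ZMod.map_smul]
    ext c
    exact hs' _ (h c)
  rw [EmbeddingLike.map_eq_zero_iff] at h₁
  have h₂ : s * x a = 0 := DFunLike.congr_fun h₁ a
  exact hs ((hx.mul_left_eq_zero).1 h₂)

end Coordinates

/-! ### Vectors with prescribed coordinates in infinite rank -/

section InfiniteRank

open Cardinal

universe u

variable {n : ℕ} [NeZero n] {E : Type u} [Infinite E]

lemma mk_union_lt {T S : Set E} (hT : #T < #E) (hS : #S < #E) : #(T ∪ S : Set E) < #E :=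
  (mk_union_le T S).trans_lt (add_lt_of_lt (aleph0_le_mk E) hT hS)

lemma mk_finset_lt (s : Finset E) : #(s : Set E) < #E :=
  ((lt_aleph0_iff_set_finite).2 s.finite_toSet).trans_le (aleph0_le_mk E)

/-- For a set `T` of coordinates smaller than `E` there is a vector `x` with a coordinate `1` such
that `x` and `φ x` vanish on `T`: the columns of `φ` outside `T`, restricted to `T`, are more
numerous than the vectors over `T`, so that two of them agree; take the difference of the
corresponding unit vectors. -/
lemma exists_vanishing_on (hn : 1 < n) (φ : (E →₀ ZMod n) ≃+ (E →₀ ZMod n)) {T : Set E}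
    (hT : #T < #E) :
    ∃ (x : E →₀ ZMod n) (a : E), x a = 1 ∧ (∀ t ∈ T, x t = 0) ∧ ∀ t ∈ T, φ x t = 0 := by
  classical
  have : Fact (1 < n) := ⟨hn⟩
  have hcard : #(T →₀ ZMod n) < #(Tᶜ : Set E) := by
    rw [mk_compl_of_infinite T hT]
    rcases finite_or_infinite T with h | h
    · have : Finite (T →₀ ZMod n) := .of_injective _ DFunLike.coe_injective
      exact (lt_aleph0_of_finite _).trans_le (aleph0_le_mk E)
    · rw [mk_finsupp_lift_of_infinite]
      refine max_lt (by simpa using hT) ?_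
      exact (lift_lt_aleph0.2 (lt_aleph0_of_finite (ZMod n))).trans_le (aleph0_le_mk E)
  let c : (Tᶜ : Set E) → (T →₀ ZMod n) := fun a ↦
    (φ (Finsupp.single (a : E) 1)).subtypeDomain (· ∈ T)
  obtain ⟨a, b, hab, hne⟩ : ∃ a b, c a = c b ∧ a ≠ b := by
    by_contra! h
    exact hcard.not_ge (mk_le_of_injective fun a b hab ↦ h a b hab)
  have hne' : (b : E) ≠ a := fun h ↦ hne (Subtype.ext h.symm)
  refine ⟨Finsupp.single (a : E) 1 - Finsupp.single (b : E) 1, a, ?_, fun t ht ↦ ?_, fun t ht ↦ ?_⟩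
  · simp [hne']
  · have h₁ : (a : E) ≠ t := fun h ↦ a.2 (h ▸ ht)
    have h₂ : (b : E) ≠ t := fun h ↦ b.2 (h ▸ ht)
    simp [h₁, h₂]
  · have := DFunLike.congr_fun hab ⟨t, ht⟩
    rw [map_sub, Finsupp.sub_apply, sub_eq_zero]
    exact this

/-- As `exists_vanishing_on`, with a coordinate `1` in both `x` and `φ x`: add to a first such
vector a suitable multiple of a second one, whose support and whose image have support disjoint
from those of the first. -/
lemma exists_vanishing_on_of_coord_one (hn : 1 < n)
    (hn' : ∃ s : ZMod n, s ≠ 0 ∧ ∀ r, ¬IsUnit r → s * r = 0)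
    (φ : (E →₀ ZMod n) ≃+ (E →₀ ZMod n)) {T : Set E} (hT : #T < #E) :
    ∃ x : E →₀ ZMod n, (∃ a, x a = 1) ∧ (∃ c, φ x c = 1) ∧
      (∀ t ∈ T, x t = 0) ∧ ∀ t ∈ T, φ x t = 0 := by
  classical
  have : Fact (1 < n) := ⟨hn⟩
  obtain ⟨x₁, a₁, h₁, hx₁, hy₁⟩ := exists_vanishing_on hn φ hT
  obtain ⟨x₂, a₂, h₂, hx₂, hy₂⟩ := exists_vanishing_on hn φ
    (mk_union_lt hT (mk_finset_lt (x₁.support ∪ (φ x₁).support)))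
  obtain ⟨c, hc⟩ := exists_isUnit_apply hn' φ (x := x₂) (a := a₂) (h₂ ▸ isUnit_one)
  refine ⟨x₁ + (↑hc.unit⁻¹ : ZMod n) • x₂, ⟨a₁, ?_⟩, ⟨c, ?_⟩, fun t ht ↦ ?_, fun t ht ↦ ?_⟩
  · have : x₂ a₁ = 0 := hx₂ a₁ (by simp [h₁])
    simp [h₁, this]
  · have : φ x₁ c = 0 := by
      by_contra h
      rw [hy₂ c (by simp [h])] at hc
      exact not_isUnit_zero hc
    simp [ZMod.map_smul, this]
  · simp [hx₁ t ht, hx₂ t (.inl ht)]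
  · simp [ZMod.map_smul, hy₁ t ht, hy₂ t (.inl ht)]

/-- There is a family of `#E` vectors such that both it and its image under `φ` have the identity as
coordinate matrix on suitable sets of coordinates, each with complement of cardinality `#E`. Indeed,
a maximal family of vectors as in `exists_vanishing_on_of_coord_one` with disjoint supports involves
`#E` coordinates, so it has `#E` members, of which one half is kept. -/
lemma exists_dual_family (hn : 1 < n)
    (hn' : ∃ s : ZMod n, s ≠ 0 ∧ ∀ r, ¬IsUnit r → s * r = 0)
    (φ : (E →₀ ZMod n) ≃+ (E →₀ ZMod n)) :
    ∃ (x : E → E →₀ ZMod n) (e₁ e₂ : E ⊕ E ≃ E),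
      (∀ k l, x k (e₁ (.inl l)) = Finsupp.single k 1 l) ∧
      ∀ k l, φ (x k) (e₂ (.inl l)) = Finsupp.single k 1 l := by
  classical
  have : Fact (1 < n) := ⟨hn⟩
  -- The coordinates involved in `x` or in its image.
  let S : (E →₀ ZMod n) → Set E := fun x ↦ ↑(x.support ∪ (φ x).support)
  let good : Set (E →₀ ZMod n) := {x | (∃ a, x a = 1) ∧ ∃ c, φ x c = 1}
  obtain ⟨Y, hY⟩ := zorn_subset {Y : Set (E →₀ ZMod n) | Y ⊆ good ∧ Y.PairwiseDisjoint S}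
    fun c hc hchain ↦ ⟨⋃₀ c, ⟨Set.sUnion_subset fun s hs ↦ (hc hs).1,
      (Set.pairwiseDisjoint_sUnion hchain.directedOn).2 fun s hs ↦ (hc hs).2⟩,
      fun s hs ↦ Set.subset_sUnion_of_mem hs⟩
  obtain ⟨hYgood, hYdisj⟩ := hY.prop
  let T : Set E := ⋃ x : Y, S x
  -- Otherwise a vector avoiding `T` could be added to the maximal family `Y`.
  have hT : #T = #E := by
    refine (mk_set_le T).eq_of_not_lt fun hlt ↦ ?_
    obtain ⟨x, ⟨a, ha⟩, hc, hx, hφx⟩ := exists_vanishing_on_of_coord_one hn hn' φ hlt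
    have hST : Disjoint (S x) T := by
      rw [Set.disjoint_left]
      intro t ht htT
      rcases Finset.mem_union.1 ht with h | h
      · exact Finsupp.mem_support_iff.1 h (hx t htT)
      · exact Finsupp.mem_support_iff.1 h (hφx t htT)
    have haS : a ∈ S x := Finset.mem_union_left _ (by simp [ha])
    have hxY : x ∈ Y := by
      refine hY.le_of_ge ⟨Set.insert_subset ⟨⟨a, ha⟩, hc⟩ hYgood,
        hYdisj.insert fun y hy _ ↦ hST.mono_right ?_⟩ (Set.subset_insert x Y) (Set.mem_insert x Y)
      exact Set.subset_iUnion (fun x : Y ↦ S x) ⟨y, hy⟩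
    exact Set.disjoint_left.1 hST haS (Set.mem_iUnion.2 ⟨⟨x, hxY⟩, haS⟩)
  choose a ha using fun x : Y ↦ (hYgood x.2).1
  choose c hc using fun x : Y ↦ (hYgood x.2).2
  have haS : ∀ x : Y, a x ∈ S x := fun x ↦ Finset.mem_union_left _ (by simp [ha])
  have hcS : ∀ x : Y, c x ∈ S x := fun x ↦ Finset.mem_union_right _ (by simp [hc])
  have hne : ∀ x y : Y, x ≠ y → ∀ t ∈ S x, t ∉ S y := fun x y hxy t htx hty ↦
    Set.disjoint_left.1 (hYdisj x.2 y.2 fun h ↦ hxy (Subtype.ext h)) htx hty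
  have hainj : Function.Injective a := fun x y h ↦ by
    by_contra hxy
    exact hne x y hxy _ (haS x) (h ▸ haS y)
  have hcinj : Function.Injective c := fun x y h ↦ by
    by_contra hxy
    exact hne x y hxy _ (hcS x) (h ▸ hcS y)
  have hYE : #Y = #E := by
    have h₁ : Infinite Y := by
      by_contra hfin
      rw [not_infinite_iff_finite] at hfin
      have : T.Finite := Set.finite_iUnion fun x : Y ↦ Finset.finite_toSet _
      exact (aleph0_le_mk E).not_gt (hT ▸ lt_aleph0_iff_set_finite.2 this)
    refine le_antisymm (mk_le_of_injective hainj) ?_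
    calc #E = #T := hT.symm
      _ ≤ #Y * ⨆ x : Y, #(S x) := mk_iUnion_le _
      _ ≤ #Y * ℵ₀ := mul_le_mul_right (ciSup_le' fun x ↦ (lt_aleph0_of_finite _).le) _
      _ ≤ #Y := mul_le_of_le (aleph0_le_mk Y) le_rfl (aleph0_le_mk Y)
  -- Half of the family leaves at least as many coordinates unused.
  have hsum : #(E ⊕ E) = #Y := by rw [mk_sum, hYE]; simp
  obtain ⟨y⟩ := Cardinal.eq.1 hsum
  have extend : ∀ d : Y → E, Function.Injective d →
      ∃ e : E ⊕ E ≃ E, ∀ l, e (.inl l) = d (y (.inl l)) := by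
    intro d hd
    have hinj : Function.Injective fun l ↦ d (y (.inl l)) :=
      hd.comp (y.injective.comp Sum.inl_injective)
    have hcompl : #E = #((Set.range fun l ↦ d (y (.inl l)))ᶜ : Set E) := by
      refine le_antisymm ?_ (mk_set_le _)
      refine mk_le_of_injective (f := fun l ↦ ⟨d (y (.inr l)), ?_⟩) fun l m hlm ↦ ?_
      · rintro ⟨m, hm⟩
        simpa using y.injective (hd hm)
      · simpa using y.injective (hd (Subtype.mk.inj hlm))
    obtain ⟨f⟩ := Cardinal.eq.1 hcompl
    exact ⟨((Equiv.ofInjective _ hinj).sumCongr f).trans (Equiv.Set.sumCompl _), fun l ↦ rfl⟩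
  obtain ⟨e₁, he₁⟩ := extend a hainj
  obtain ⟨e₂, he₂⟩ := extend c hcinj
  refine ⟨fun k ↦ y (.inl k), e₁, e₂, fun k l ↦ ?_, fun k l ↦ ?_⟩
  · rw [he₁]
    rcases eq_or_ne k l with rfl | hkl
    · simp [ha]
    · rw [Finsupp.single_eq_of_ne' hkl]
      have := hne (y (.inl l)) (y (.inl k)) (by simpa using hkl.symm) _ (haS _)
      by_contra h
      exact this (Finset.mem_union_left _ (by simpa using h))
  · rw [he₂]
    rcases eq_or_ne k l with rfl | hkl
    · simp [hc]
    · rw [Finsupp.single_eq_of_ne' hkl]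
      have := hne (y (.inl l)) (y (.inl k)) (by simpa using hkl.symm) _ (hcS _)
      by_contra h
      exact this (Finset.mem_union_right _ (by simpa using h))

end InfiniteRank

/-! ### Lifting automorphisms of coordinate modules -/

open Cardinal in
/-- The swindle in coordinates: as `E` is infinite, the first summand is isomorphic to two copies of
the sum of countably many copies of the second. -/
lemma Liftable.refl_prodCongr_of_infinite (n : ℕ) {E : Type*} [Infinite E]
    (θ : (E →₀ ZMod n) ≃+ (E →₀ ZMod n)) :
    Liftable ((reduce n E).prodMap (reduce n E)) ((reduce n E).prodMap (reduce n E))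
      ((AddEquiv.refl (E →₀ ZMod n)).prodCongr θ) := by
  obtain ⟨e⟩ : Nonempty (E ≃ (ℕ × E) ⊕ (ℕ × E)) := by
    rw [← Cardinal.eq]
    simp
  have hβ := ((Liftable.domCongr (Int.castAddHom (ZMod n)) e).trans
    (Liftable.sumFinsupp (Int.castAddHom (ZMod n)) (ℕ × E) (ℕ × E))).trans
      ((Liftable.curry (Int.castAddHom (ZMod n)) ℕ E).prodCongr
        (Liftable.curry (Int.castAddHom (ZMod n)) ℕ E))
  have hγ := (Liftable.prodComm (reduce n E) (reduce n E)).trans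
    ((Liftable.refl (reduce n E)).prodCongr hβ)
  refine (hγ.trans ((Liftable.prodCongr_refl_refl (reduce_surjective n E) θ).trans
    hγ.symm)).congr fun z ↦ ?_
  rw [AddEquiv.trans_apply, AddEquiv.trans_apply, AddEquiv.symm_apply_eq]
  rfl

/-- In infinite rank every automorphism modulo `n` lifts: by `exists_dual_family` it is, up to
liftable automorphisms, of the form `1 ⊕ θ`, with summands of the same rank. -/
lemma liftable_of_infinite {n : ℕ} [NeZero n] (hn : 1 < n)
    (hn' : ∃ s : ZMod n, s ≠ 0 ∧ ∀ r, ¬IsUnit r → s * r = 0) {E : Type*} [Infinite E]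
    (φ : (E →₀ ZMod n) ≃+ (E →₀ ZMod n)) : Liftable (reduce n E) (reduce n E) φ := by
  obtain ⟨x, e₁, e₂, h₁, h₂⟩ := exists_dual_family hn hn' φ
  let α : (E ⊕ E ≃ E) → ((E →₀ ZMod n) ≃+ (E →₀ ZMod n) × (E →₀ ZMod n)) := fun e ↦
    (Finsupp.domCongr e.symm).trans Finsupp.sumFinsuppAddEquivProdFinsupp
  have hα : ∀ e, Liftable (reduce n E) ((reduce n E).prodMap (reduce n E)) (α e) := fun e ↦
    (Liftable.domCongr _ _).trans (Liftable.sumFinsupp _ _ _)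
  have hα_fst : ∀ e v l, (α e v).1 l = v (e (.inl l)) := fun e v l ↦ rfl
  let X : (E →₀ ZMod n) →ₗ[ZMod n] (E →₀ ZMod n) := Finsupp.linearCombination (ZMod n) x
  -- Both `X` and `φ ∘ X` are sections of a projection onto the first summand.
  have section_eq : ∀ (e : E ⊕ E ≃ E) (Y : (E →₀ ZMod n) →+ (E →₀ ZMod n)),
      (∀ k l, Y (Finsupp.single k 1) (e (.inl l)) = Finsupp.single k 1 l) →
      ∀ v, (α e (Y v)).1 = v := by
    intro e Y hY v
    refine DFunLike.congr_fun (f := (AddMonoidHom.fst _ _).comp ((α e).toAddMonoidHom.comp Y))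
      (g := AddMonoidHom.id _) (Finsupp.addHom_ext fun k r ↦ ?_) v
    ext l
    change Y (Finsupp.single k r) (e (.inl l)) = Finsupp.single k r l
    rw [← mul_one r, ← smul_eq_mul, ← Finsupp.smul_single, ZMod.map_smul, Finsupp.smul_apply, hY,
      Finsupp.smul_apply]
  have hX₁ := section_eq e₁ X.toAddMonoidHom fun k l ↦ by simpa [X] using h₁ k l
  have hX₂ := section_eq e₂ (φ.toAddMonoidHom.comp X.toAddMonoidHom) fun k l ↦ by
    simpa [X] using h₂ k l
  have key := Liftable.of_map_graph_eq_graph (φ := (α e₁).symm.trans (φ.trans (α e₂)))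
    (reduce_surjective n E) (reduce_surjective n E)
    ((AddMonoidHom.snd _ _).comp ((α e₁).toAddMonoidHom.comp X.toAddMonoidHom))
    ((AddMonoidHom.snd _ _).comp ((α e₂).toAddMonoidHom.comp
      (φ.toAddMonoidHom.comp X.toAddMonoidHom))) ?_ (Liftable.refl_prodCongr_of_infinite n)
  · refine ((hα e₁).trans (key.trans (hα e₂).symm)).congr fun v ↦ ?_
    simp
  · intro v
    have : (v, (α e₁ (X v)).2) = α e₁ (X v) := Prod.ext (hX₁ v).symm rfl
    change α e₂ (φ ((α e₁).symm (v, (α e₁ (X v)).2))) = (v, (α e₂ (φ (X v))).2)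
    rw [this, AddEquiv.symm_apply_apply]
    exact Prod.ext (hX₂ v) rfl

/-- In finite rank an automorphism modulo `n` lifts after rescaling the basis vectors by units.
Once the first basis vector is rescaled so that its image has a coordinate `1`, that image is part
of a liftable basis, which splits off a summand of rank one. -/
lemma exists_scaling_liftable {n : ℕ}
    (hn' : ∃ s : ZMod n, s ≠ 0 ∧ ∀ r, ¬IsUnit r → s * r = 0) {m : ℕ}
    (φ : (Fin m →₀ ZMod n) ≃+ (Fin m →₀ ZMod n)) :
    ∃ (u : Fin m → (ZMod n)ˣ) (δ : (Fin m →₀ ZMod n) ≃+ (Fin m →₀ ZMod n)),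
      (∀ i r, δ (Finsupp.single i r) = Finsupp.single i (u i * r)) ∧
      Liftable (reduce n (Fin m)) (reduce n (Fin m)) (δ.trans φ) := by
  induction m with
  | zero =>
    exact ⟨fun _ ↦ 1, AddEquiv.refl _, fun i ↦ i.elim0, AddEquiv.refl _,
      fun x ↦ Subsingleton.elim _ _⟩
  | succ m ih =>
    let e : Unit ⊕ Fin m ≃ Fin (m + 1) :=
      (Equiv.sumComm _ _).trans ((Equiv.optionEquivSumPUnit _).symm.trans (finSuccEquiv m).symm)
    obtain ⟨c, hc⟩ := exists_isUnit_apply hn' φ (x := Finsupp.single 0 1) (a := 0) (by simp)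
    let α : (Unit ⊕ Fin m ≃ Fin (m + 1)) →
        ((Fin (m + 1) →₀ ZMod n) ≃+ (Unit →₀ ZMod n) × (Fin m →₀ ZMod n)) := fun e ↦
      (Finsupp.domCongr e.symm).trans Finsupp.sumFinsuppAddEquivProdFinsupp
    have hα : ∀ e, Liftable (reduce n _) ((reduce n _).prodMap (reduce n _)) (α e) := fun e ↦
      (Liftable.domCongr _ _).trans (Liftable.sumFinsupp _ _ _)
    have hα_inl : ∀ e r, α e (Finsupp.single (e (.inl ())) r) = (Finsupp.single () r, 0) := by
      intro e r
      refine Prod.ext (Finsupp.ext fun j ↦ ?_) (Finsupp.ext fun j ↦ ?_)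
      · change Finsupp.single (e (.inl ())) r (e (.inl j)) = Finsupp.single () r j
        simp
      · change Finsupp.single (e (.inl ())) r (e (.inr j)) = 0
        simp
    have hα_inr : ∀ e i r, α e (Finsupp.single (e (.inr i)) r) = (0, Finsupp.single i r) := by
      intro e i r
      refine Prod.ext (Finsupp.ext fun j ↦ ?_) (Finsupp.ext fun j ↦ ?_)
      · change Finsupp.single (e (.inr i)) r (e (.inl j)) = 0
        simp
      · change Finsupp.single (e (.inr i)) r (e (.inr j)) = Finsupp.single i r j
        simp [Finsupp.single_apply]
    -- The coordinate `c` takes the place of the first one on the target side.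
    let e' := e.trans (Equiv.swap 0 c)
    let U : (Unit →₀ ZMod n) ≃+ (Unit →₀ ZMod n) :=
      Finsupp.mapRange.addEquiv (DistribMulAction.toAddEquiv (ZMod n) hc.unit⁻¹)
    have hU : ∀ r, U (Finsupp.single () r) = Finsupp.single () ((↑hc.unit⁻¹ : ZMod n) * r) :=
      fun r ↦ by simp [U, Units.smul_def]
    let φ₁ := (U.prodCongr (AddEquiv.refl _)).trans ((α e).symm.trans (φ.trans (α e')))
    have hφ₁ : ∀ x, (φ₁ (x, 0)).1 = x := by
      intro x
      obtain ⟨r, rfl⟩ : ∃ r, x = Finsupp.single () r := ⟨x (), by ext; simp⟩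
      have h₁ : (α e).symm (U (Finsupp.single () r), 0) =
          ((↑hc.unit⁻¹ : ZMod n) * r) • Finsupp.single 0 1 := by
        rw [AddEquiv.symm_apply_eq, Finsupp.smul_single, smul_eq_mul, mul_one, hU]
        exact (hα_inl e _).symm
      refine Finsupp.ext fun j ↦ ?_
      change φ ((α e).symm (U (Finsupp.single () r), 0)) (Equiv.swap 0 c 0) = Finsupp.single () r j
      rw [h₁, ZMod.map_smul, Finsupp.smul_apply, Equiv.swap_apply_left, smul_eq_mul,
        mul_right_comm, hc.val_inv_mul, one_mul]
      simp
    obtain ⟨θ, hθ⟩ := exists_liftable_of_map_eq_graph (φ := φ₁)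
      (reduce_surjective n Unit) (reduce_surjective n (Fin m))
      ((AddMonoidHom.snd _ _).comp (φ₁.toAddMonoidHom.comp (AddMonoidHom.inl _ _)))
      fun x ↦ Prod.ext (hφ₁ x) rfl
    obtain ⟨u, δ, hδ, hl⟩ := ih θ
    have hl' := hθ δ ((Liftable.refl _).prodCongr hl)
    refine ⟨Fin.cons hc.unit⁻¹ u, (α e).trans ((U.prodCongr δ).trans (α e).symm), ?_, ?_⟩
    · intro i r
      rw [AddEquiv.trans_apply, AddEquiv.trans_apply, AddEquiv.symm_apply_eq]
      refine Fin.cases ?_ (fun i ↦ ?_) i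
      · refine (congrArg _ (hα_inl e r)).trans (.trans ?_ (hα_inl e _).symm)
        simp [AddEquiv.prodCongr_apply, hU]
      · refine (congrArg _ (hα_inr e i r)).trans (.trans ?_ (hα_inr e i _).symm)
        simp [AddEquiv.prodCongr_apply, hδ]
    · refine ((hα e).trans (hl'.trans (hα e').symm)).congr fun v ↦ ?_
      simp [φ₁, AddEquiv.prodCongr_apply]

/-! ### Lifting bases -/

/-- In coordinates with respect to a basis of `G`, the quotient map `G → G/nG` is `reduce`. -/
lemma mkQ_repr_symm_eq {G : Type*} [AddCommGroup G] {n : ℕ} [NeZero n] {I : Type*}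
    (e : Module.Basis I ℤ G) (v : I →₀ ℤ) :
    ModN.mkQ n (e.repr.symm v) = (ModN.basis (n := n) e).repr.symm (reduce n I v) := by
  refine DFunLike.congr_fun (f := (ModN.mkQ n).comp e.repr.symm.toAddEquiv.toAddMonoidHom)
    (g := (ModN.basis (n := n) e).repr.symm.toAddEquiv.toAddMonoidHom.comp (reduce n I))
    (Finsupp.addHom_ext fun i r ↦ ?_) v
  have h : reduce n I (Finsupp.single i r) = Finsupp.single i (r : ZMod n) :=
    Finsupp.mapRange_single (hf := map_zero _)
  change ModN.mkQ n (e.repr.symm (Finsupp.single i r)) =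
    (ModN.basis (n := n) e).repr.symm (reduce n I (Finsupp.single i r))
  rw [h, Module.Basis.repr_symm_single, Module.Basis.repr_symm_single, map_zsmul,
    ModN.basis_apply_eq_mkQ, Int.cast_smul_eq_zsmul]

lemma exists_basis_mkQ_eq_smul {G : Type*} [AddCommGroup G] [Module.Free ℤ G] {p ν : ℕ}
    (hp : p.Prime) (hν : 1 ≤ ν) {I : Type*}
    (b : Module.Basis I (ZMod (p ^ ν)) (ModN G (p ^ ν))) :
    ∃ (u : I → ℤ) (y : Module.Basis I ℤ G),
      ∀ i, IsCoprime (u i) (p : ℤ) ∧ ModN.mkQ (p ^ ν) (y i) = u i • b i := by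
  have hn : 1 < p ^ ν := one_lt_pow₀ hp.one_lt (by omega)
  have : NeZero (p ^ ν) := ⟨by omega⟩
  have : Fact (1 < p ^ ν) := ⟨hn⟩
  have hn' := exists_ne_zero_mul_nonunit_eq_zero hp hν
  -- The rank is determined modulo `p ^ ν`, so `G` has a basis indexed by `I`.
  let e₀ := Module.Free.chooseBasis ℤ G
  let e : Module.Basis I ℤ G := e₀.reindex ((ModN.basis (n := p ^ ν) e₀).indexEquiv b)
  -- It suffices to lift the change of basis, after rescaling by units.
  suffices h : ∀ φ : (I →₀ ZMod (p ^ ν)) ≃+ (I →₀ ZMod (p ^ ν)),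
      ∃ (u : I → (ZMod (p ^ ν))ˣ) (ψ : (I →₀ ℤ) ≃+ (I →₀ ℤ)), ∀ i,
        reduce _ I (ψ (Finsupp.single i 1)) = φ (Finsupp.single i (u i : ZMod (p ^ ν))) by
    obtain ⟨u, ψ, hψ⟩ := h (b.repr.symm.trans (ModN.basis (n := p ^ ν) e).repr).toAddEquiv
    refine ⟨fun i ↦ ((u i : ZMod (p ^ ν)).val : ℤ),
      .ofRepr (e.repr.trans ψ.symm.toIntLinearEquiv), fun i ↦ ⟨?_, ?_⟩⟩
    · exact (ZMod.val_coe_unit_coprime (u i)).coprime_dvd_right (dvd_pow_self p (by omega))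
        |> Nat.isCoprime_iff_coprime.2
    · change ModN.mkQ (p ^ ν) (e.repr.symm (ψ (Finsupp.single i 1))) = _
      rw [mkQ_repr_symm_eq, hψ]
      change (ModN.basis e).repr.symm ((ModN.basis e).repr (b.repr.symm _)) = _
      rw [LinearEquiv.symm_apply_apply, Module.Basis.repr_symm_single,
        ← Int.cast_smul_eq_zsmul (ZMod (p ^ ν)), Int.cast_natCast, ZMod.natCast_zmod_val]
  intro φ
  rcases finite_or_infinite I with hI | hI
  · obtain ⟨m, ⟨f⟩⟩ := Finite.exists_equiv_fin I
    have hf := Liftable.domCongr (Int.castAddHom (ZMod (p ^ ν))) f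
    let f' : (I →₀ ZMod (p ^ ν)) ≃+ (Fin m →₀ ZMod (p ^ ν)) := Finsupp.domCongr f
    obtain ⟨u, δ, hδ, h⟩ := exists_scaling_liftable hn' (f'.symm.trans (φ.trans f'))
    obtain ⟨ψ, hψ⟩ := hf.trans (h.trans hf.symm)
    refine ⟨u ∘ f, ψ, fun i ↦ (hψ _).trans ?_⟩
    have h₁ : f' (reduce (p ^ ν) I (Finsupp.single i 1)) = Finsupp.single (f i) 1 := by
      simp [reduce, f']
    have h₂ : f'.symm (Finsupp.single (f i) (u (f i) : ZMod (p ^ ν))) =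
        Finsupp.single i (u (f i) : ZMod (p ^ ν)) := by
      simp [f']
    change f'.symm (f' (φ (f'.symm (δ (f' (reduce (p ^ ν) I (Finsupp.single i 1))))))) = _
    rw [h₁, hδ, mul_one, h₂, AddEquiv.symm_apply_apply]
    rfl
  · obtain ⟨ψ, hψ⟩ := liftable_of_infinite hn hn' φ
    exact ⟨fun _ ↦ 1, ψ, fun i ↦ (hψ _).trans (by simp [reduce])⟩

/-! ### Free modules and direct sum decompositions -/

section Free

open IsLocalRing TensorProduct

/-- Over a local Artinian ring, flat modules of any rank are free: a lift of a basis of the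
reduction spans by Nakayama's lemma, which needs no finiteness as the maximal ideal is nilpotent. -/
lemma Module.Free.of_flat_of_isArtinianRing {R M : Type*} [CommRing R] [IsLocalRing R]
    [IsArtinianRing R] [AddCommGroup M] [Module R M] [Module.Flat R M] : Module.Free R M := by
  let w := Module.Free.chooseBasis (ResidueField R) (ResidueField R ⊗[R] M)
  obtain ⟨v, hv⟩ := (TensorProduct.mk_surjective R M (ResidueField R)
    Ideal.Quotient.mk_surjective).comp_left w
  have hli : LinearIndependent (ResidueField R) (TensorProduct.mk R (ResidueField R) M 1 ∘ v) :=
    (show TensorProduct.mk R (ResidueField R) M 1 ∘ v = w from hv) ▸ w.linearIndependent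
  refine .of_basis (.mk (IsLocalRing.linearIndependent_of_flat v hli) ?_)
  set N := Submodule.span R (Set.range v)
  have hmap : N.map (TensorProduct.mk R (ResidueField R) M 1) = ⊤ := by
    rw [Submodule.map_span, ← Submodule.restrictScalars_span R (ResidueField R)
      Ideal.Quotient.mk_surjective, Submodule.restrictScalars_eq_top_iff, ← w.span_eq,
      ← Set.range_comp]
    exact congrArg _ (congrArg _ hv)
  have hN : ⊤ ≤ N ⊔ maximalIdeal R • (⊤ : Submodule R M) := by
    rw [← LinearMap.ker_tensorProductMk, ← Submodule.comap_map_eq]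
    exact fun x _ ↦ hmap.ge Submodule.mem_top
  have hpow : ∀ k, ⊤ ≤ N ⊔ maximalIdeal R ^ k • (⊤ : Submodule R M) := by
    intro k
    induction k with
    | zero => simp
    | succ k ih =>
      refine hN.trans (sup_le le_sup_left ?_)
      calc maximalIdeal R • (⊤ : Submodule R M)
          ≤ maximalIdeal R • (N ⊔ maximalIdeal R ^ k • (⊤ : Submodule R M)) :=
            Submodule.smul_mono le_rfl ih
        _ ≤ _ := by
            rw [Submodule.smul_sup, ← mul_smul, ← pow_succ']
            exact sup_le_sup_right Submodule.smul_le_right _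
  obtain ⟨k, hk⟩ := IsArtinianRing.isNilpotent_jacobson_bot (R := R)
  rw [IsLocalRing.jacobson_eq_maximalIdeal _ bot_ne_top] at hk
  simpa [hk] using hpow k

lemma ZMod.isLocalRing_prime_pow {p ν : ℕ} (hp : p.Prime) (hν : 1 ≤ ν) :
    IsLocalRing (ZMod (p ^ ν)) := by
  have : Fact (1 < p ^ ν) := ⟨one_lt_pow₀ hp.one_lt (by omega)⟩
  obtain ⟨s, hs, hs'⟩ := exists_ne_zero_mul_nonunit_eq_zero hp hν
  refine .of_isUnit_or_isUnit_one_sub_self fun r ↦ ?_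
  by_contra! h
  exact hs (by linear_combination hs' r h.1 + hs' (1 - r) h.2)

end Free

/-- Partitioning a basis gives an internal direct sum decomposition. -/
lemma Module.Basis.isInternal_span_sigma {R M J : Type*} [Ring R] [AddCommGroup M]
    [Module R M] [DecidableEq J] {α : J → Type*} (y : Module.Basis (Σ j, α j) R M) :
    DirectSum.IsInternal fun j ↦ Submodule.span R (Set.range fun i ↦ y ⟨j, i⟩) := by
  rcases subsingleton_or_nontrivial R with h | h
  · have := Module.subsingleton R M
    exact DirectSum.isInternal_submodule_of_iSupIndep_of_iSup_eq_top
      (fun _ ↦ by simp [Subsingleton.elim _ (⊥ : Submodule R M)]) (Subsingleton.elim _ _)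
  have hle : ∀ j, Submodule.span R (Set.range fun i ↦ y ⟨j, i⟩) ≤
      Submodule.span R (y '' {s | s.1 = j}) := fun j ↦ by
    refine Submodule.span_mono ?_
    rintro _ ⟨i, rfl⟩
    exact ⟨_, rfl, rfl⟩
  refine DirectSum.isInternal_submodule_of_iSupIndep_of_iSup_eq_top (fun j ↦ ?_) ?_
  · refine (y.linearIndependent.disjoint_span_image (s := {s | s.1 = j}) (t := {s | s.1 ≠ j})
      (Set.disjoint_left.2 fun s hs ht ↦ ht hs)).mono (hle j) (iSup₂_le fun k hk ↦ ?_)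
    refine (hle k).trans (Submodule.span_mono (Set.image_mono ?_))
    rintro s rfl
    exact hk
  · rw [eq_top_iff, ← y.span_eq, Submodule.span_le]
    rintro _ ⟨⟨j, i⟩, rfl⟩
    exact Submodule.mem_iSup_of_mem j (Submodule.subset_span ⟨i, rfl⟩)

open DirectSum in
lemma exists_isInternal_map_mkQ_eq {G : Type*} [AddCommGroup G] [Module.Free ℤ G] {p ν : ℕ}
    (hp : p.Prime) (hν : 1 ≤ ν) {J : Type*} [DecidableEq J]
    (M : J → AddSubgroup (ModN G (p ^ ν))) (hM : IsInternal M) :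
    ∃ N : J → AddSubgroup G, IsInternal N ∧
      ∀ j, (N j).map (ModN.mkQ (G := G) (p ^ ν) : G →+ ModN G (p ^ ν)) = M j := by
  have hloc := ZMod.isLocalRing_prime_pow hp hν
  have : NeZero (p ^ ν) := ⟨pow_ne_zero _ hp.ne_zero⟩
  let M' : J → Submodule (ZMod (p ^ ν)) (ModN G (p ^ ν)) := fun j ↦
    AddSubgroup.toZModSubmodule _ (M j)
  have hM' : IsInternal M' := hM
  have : Module.Free (ZMod (p ^ ν)) (ModN G (p ^ ν)) :=
    .of_basis (ModN.basis (Module.Free.chooseBasis ℤ G))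
  have hproj : ∀ j, Module.Projective (ZMod (p ^ ν)) (M' j) := fun j ↦
    .of_split (M' j).subtype
      ((DirectSum.component (ZMod (p ^ ν)) J (fun j ↦ M' j) j) ∘ₗ
        (LinearEquiv.ofBijective (DirectSum.coeLinearMap M') hM').symm.toLinearMap)
      (by
        ext x
        exact congrArg _ (hM'.ofBijective_coeLinearMap_same x))
  have hfree : ∀ j, Module.Free (ZMod (p ^ ν)) (M' j) := fun j ↦
    .of_flat_of_isArtinianRing
  let c := fun j ↦ Module.Free.chooseBasis (ZMod (p ^ ν)) (M' j)
  obtain ⟨u, y, hy⟩ := exists_basis_mkQ_eq_smul hp hν (hM'.collectedBasis c)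
  have hb : ∀ j i, ModN.mkQ (p ^ ν) (y ⟨j, i⟩) = u ⟨j, i⟩ • (c j i : ModN G (p ^ ν)) :=
    fun j i ↦ by rw [(hy _).2, hM'.collectedBasis_coe]
  refine ⟨fun j ↦ (Submodule.span ℤ (Set.range fun i ↦ y ⟨j, i⟩)).toAddSubgroup,
    y.isInternal_span_sigma, fun j ↦ le_antisymm ?_ ?_⟩
  · rintro _ ⟨x, hx, rfl⟩
    induction (hx : x ∈ Submodule.span ℤ _) using Submodule.span_induction with
    | mem x h =>
      obtain ⟨i, rfl⟩ := h
      exact (hb j i).symm ▸ zsmul_mem (c j i).2 _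
    | zero => exact (map_zero (ModN.mkQ (G := G) (p ^ ν))).symm ▸ zero_mem _
    | add x y _ _ h₁ h₂ => exact (map_add (ModN.mkQ (p ^ ν)) x y).symm ▸ add_mem h₁ h₂
    | smul a x _ h => exact (map_zsmul (ModN.mkQ (p ^ ν)) a x).symm ▸ zsmul_mem h a
  · set K := (Submodule.span ℤ (Set.range fun i ↦ y ⟨j, i⟩)).toAddSubgroup.map
      (ModN.mkQ (G := G) (p ^ ν) : G →+ ModN G (p ^ ν))
    -- The scalars `u` are invertible modulo `p ^ ν`.
    have hc : ∀ i, (c j i : ModN G (p ^ ν)) ∈ K := by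
      intro i
      obtain ⟨a, d, had⟩ := (hy ⟨j, i⟩).1.pow_right (n := ν)
      have h₀ : ((p : ℤ) ^ ν) • (c j i : ModN G (p ^ ν)) = 0 := by
        rw [← Int.cast_smul_eq_zsmul (ZMod (p ^ ν))]
        have : (((p : ℤ) ^ ν : ℤ) : ZMod (p ^ ν)) = 0 := by
          exact_mod_cast ZMod.natCast_self (p ^ ν)
        rw [this, zero_smul]
      have h₁ : (c j i : ModN G (p ^ ν)) = a • ModN.mkQ (p ^ ν) (y ⟨j, i⟩) := by
        rw [hb, smul_smul]
        conv_lhs => rw [← one_zsmul (c j i : ModN G (p ^ ν)), ← had, add_smul, mul_smul d, h₀,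
          smul_zero, add_zero]
      rw [h₁]
      have hmem : y ⟨j, i⟩ ∈ Submodule.span ℤ (Set.range fun i ↦ y ⟨j, i⟩) :=
        Submodule.subset_span ⟨i, rfl⟩
      exact zsmul_mem (AddSubgroup.mem_map_of_mem _ hmem) a
    have hle : M' j ≤ AddSubgroup.toZModSubmodule (p ^ ν) K := by
      rw [← Submodule.map_subtype_top (M' j), ← (c j).span_eq, Submodule.map_span,
        Submodule.span_le]
      rintro _ ⟨_, ⟨i, rfl⟩, rfl⟩
      exact hc i
    exact hle

theorem mainTheorem2 {G : Type*} [AddCommGroup G] [Module.Free ℤ G]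
    (p ν : ℕ) (hp : p.Prime) (hν : 1 ≤ ν) :
    (∀ {I : Type*} (b : Module.Basis I (ZMod (p ^ ν)) (ModN G (p ^ ν))),
      ∃ (u : I → ℤ) (y : Module.Basis I ℤ G),
        ∀ α : I, IsCoprime (u α) (p : ℤ) ∧ ModN.mkQ (p ^ ν) (y α) = u α • b α) ∧
    (∀ {J : Type*} [DecidableEq J] (M : J → AddSubgroup (ModN G (p ^ ν))),
      DirectSum.IsInternal M →
      ∃ N : J → AddSubgroup G, DirectSum.IsInternal N ∧
        ∀ j : J, (N j).map (ModN.mkQ (G := G) (p ^ ν) : G →+ ModN G (p ^ ν)) = M j) :=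
  ⟨fun b ↦ exists_basis_mkQ_eq_smul hp hν b,
    fun M hM ↦ exists_isInternal_map_mkQ_eq hp hν M hM⟩
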